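/- Let $G=(V,E)$ be a finite connected simple graph with edge set $E=\{e_1,\dots,e_m\}$. To a positive weight $\mathbf w=(w_e)_{e\in E}\in\mathbb R_+^m=(0,\infty)^m$ associate: the distance $d(u,v)=\min_\gamma\sum_{e\in\gamma}w_e$, the minimum being over all paths $\gamma$ from $u$ to $v$; for $\alpha\in[0,1]$ and a vertex $u$ that has neighbours, the probability measure $\mu_u^\alpha$ with mass $\alpha$ at $u$ and mass $(1-\alpha)\,w_{uz}/\sum_{y\sim u}w_{uy}$ at each neighbour $z$ of $u$; the transportation distance $W$ of probability measures on $V$ with cost $d$; and the Lin–Lu–Yau Ricci curvature of adjacent vertices $u,v$, $$\kappa(u,v)=\lim_{\alpha\to1^-}\frac1{1-\alpha}\Bigl[1-\frac{W(\mu_u^\alpha,\mu_v^\alpha)}{d(u,v)}\Bigr].$$ For $e=xy\in E$ write $\rho_e=d(x,y)$ and $\kappa_e=\kappa(x,y)$. Then the limit defining $\kappa_e$ exists for every $\mathbf w\in\mathbb R_+^m$ and $e\in E$, and for every initial weight $\mathbf w_0=(w_{0,1},\dots,w_{0,m})\in\mathbb R_+^m$ the quasi-normalized Ricci flow $$\frac{d}{dt}w_{e_i}(t)=-\kappa_{e_i}(t)\rho_{e_i}(t)+\frac{\sum_{\tau\in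 E}\kappa_\tau(t)\rho_\tau(t)}{\sum_{h\in E}w_h(t)}\,\rho_{e_i}(t),\qquad w_{e_i}(0)=w_{0,i},\qquad i=1,\dots,m,$$ where $\kappa_e(t)$ and $\rho_e(t)$ are determined by $\mathbf w(t)$, has a unique solution $\mathbf w(t)=(w_{e_1}(t),\dots,w_{e_m}(t))\in\mathbb R_+^m$ for all $t\in[0,+\infty)$ (with a one-sided derivative at $t=0$). -/

import Mathlib

open Filter Topology

noncomputable section

namespace WeightedGraph

variable {V : Type*} {G : SimpleGraph V}

/-- The length of a walk for the edge weights `w`: the sum of the weights of its edges. -/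
def walkLength (w : G.edgeSet → ℝ) {u v : V} (p : G.Walk u v) : ℝ :=
  (p.darts.map fun a => w ⟨a.edge, a.edge_mem⟩).sum

/-- The distance between two vertices: the infimum of the lengths of the paths joining them. -/
def pathDist (w : G.edgeSet → ℝ) (u v : V) : ℝ :=
  ⨅ p : G.Path u v, walkLength w (p : G.Walk u v)

theorem walkLength_reverse (w : G.edgeSet → ℝ) {u v : V} (p : G.Walk u v) :
    walkLength w p.reverse = walkLength w p := by
  unfold walkLength
  rw [SimpleGraph.Walk.darts_reverse, List.map_reverse, List.sum_reverse, List.map_map]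
  congr 2
  funext a
  simp [Function.comp]

theorem pathDist_comm (w : G.edgeSet → ℝ) (u v : V) : pathDist w u v = pathDist w v u := by
  have key : ∀ a b : V, ∀ p : G.Path a b,
      walkLength w ((p.reverse : G.Path b a) : G.Walk b a) = walkLength w (p : G.Walk a b) :=
    fun a b p => walkLength_reverse w _
  refine Function.Surjective.iInf_congr (fun p : G.Path u v => p.reverse) ?_ (key u v)
  intro p
  exact ⟨p.reverse, by ext1; simp⟩

/-- The weight `w_{uv}` of the edge joining `u` and `v`, and `0` if they are not adjacent. -/
def weight [DecidableRel G.Adj] (w : G.edgeSet → ℝ) (u v : V) : ℝ :=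
  if h : G.Adj u v then w ⟨s(u, v), h⟩ else 0

variable [Fintype V]

/-- The probability `μ_u^α`: mass `α` at `u`, and mass `(1 - α) w_{uz} / ∑_{y ∼ u} w_{uy}`
at each neighbour `z` of `u`. -/
def lazyMeasure [DecidableEq V] [DecidableRel G.Adj] (w : G.edgeSet → ℝ) (α : ℝ) (u z : V) : ℝ :=
  if z = u then α
  else if G.Adj u z then (1 - α) * (weight w u z / ∑ y, weight w u y)
  else 0

/-- `π` is a coupling (transport plan) of the mass distributions `μ` and `ν`. -/
structure IsCoupling (μ ν : V → ℝ) (π : V → V → ℝ) : Prop where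
  nonneg : ∀ a b, 0 ≤ π a b
  fst : ∀ a, ∑ b, π a b = μ a
  snd : ∀ b, ∑ a, π a b = ν b

/-- The transportation (Wasserstein) distance of `μ` and `ν` for the cost `d`. -/
def transportDist (d : V → V → ℝ) (μ ν : V → ℝ) : ℝ :=
  sInf {c | ∃ π : V → V → ℝ, IsCoupling μ ν π ∧ c = ∑ a, ∑ b, π a b * d a b}

theorem transportDist_comm (d : V → V → ℝ) (hd : ∀ a b, d a b = d b a) (μ ν : V → ℝ) :
    transportDist d μ ν = transportDist d ν μ := by
  have key : ∀ μ ν : V → ℝ,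
      {c | ∃ π : V → V → ℝ, IsCoupling μ ν π ∧ c = ∑ a, ∑ b, π a b * d a b} ⊆
        {c | ∃ π : V → V → ℝ, IsCoupling ν μ π ∧ c = ∑ a, ∑ b, π a b * d a b} := by
    rintro μ ν c ⟨π, hπ, rfl⟩
    refine ⟨fun a b => π b a, ⟨fun a b => hπ.nonneg b a, hπ.snd, hπ.fst⟩, ?_⟩
    rw [Finset.sum_comm]
    exact Finset.sum_congr rfl fun a _ => Finset.sum_congr rfl fun b _ => by rw [hd]
  exact congrArg sInf (Set.Subset.antisymm (key μ ν) (key ν μ))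

variable [DecidableEq V] [DecidableRel G.Adj]

/-- The quotient `(1 - W(μ_u^α, μ_v^α) / d(u,v)) / (1 - α)`. -/
def curvatureQuotient (w : G.edgeSet → ℝ) (u v : V) (α : ℝ) : ℝ :=
  1 / (1 - α) *
    (1 - transportDist (pathDist w) (lazyMeasure w α u) (lazyMeasure w α v) / pathDist w u v)

/-- The Lin–Lu–Yau Ricci curvature `κ(u, v)`: the limit of the quotient as `α → 1`, `α < 1`. -/
def curvature (w : G.edgeSet → ℝ) (u v : V) : ℝ :=
  limUnder (𝓝[<] (1 : ℝ)) (curvatureQuotient w u v)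

theorem curvature_comm (w : G.edgeSet → ℝ) (u v : V) : curvature w u v = curvature w v u := by
  have h : curvatureQuotient w u v = curvatureQuotient w v u := by
    funext α
    unfold curvatureQuotient
    rw [transportDist_comm _ (pathDist_comm w), pathDist_comm w u v]
  unfold curvature
  rw [h]

/-- `ρ_e = d(x, y)` for the edge `e = xy`. -/
def edgeDist (w : G.edgeSet → ℝ) (e : G.edgeSet) : ℝ :=
  Sym2.lift ⟨pathDist w, pathDist_comm w⟩ (e : Sym2 V)

/-- `κ_e = κ(x, y)` for the edge `e = xy`. -/
def edgeCurvature (w : G.edgeSet → ℝ) (e : G.edgeSet) : ℝ :=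
  Sym2.lift ⟨curvature w, curvature_comm w⟩ (e : Sym2 V)

/-- The right-hand side of the quasi-normalized Ricci flow at the edge `e`. -/
def quasiNormalizedField (w : G.edgeSet → ℝ) (e : G.edgeSet) : ℝ :=
  -edgeCurvature w e * edgeDist w e +
    (∑ τ, edgeCurvature w τ * edgeDist w τ) / (∑ h, w h) * edgeDist w e

/-- `w` solves the quasi-normalized Ricci flow on `[0, ∞)` with initial weight `w₀`, within the
positive weights (the derivative at `t = 0` is one-sided; `w t` for `t < 0` plays no role). -/
structure IsQuasiNormalizedFlow (w₀ : G.edgeSet → ℝ) (w : ℝ → G.edgeSet → ℝ) : Prop where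
  initial : w 0 = w₀
  pos : ∀ t, 0 ≤ t → ∀ e, 0 < w t e
  deriv : ∀ t, 0 ≤ t → ∀ e,
    HasDerivWithinAt (fun s => w s e) (quasiNormalizedField (w t) e) (Set.Ici 0) t

end WeightedGraph

end

/-! The curvature enters the flow only through the products κ_e ρ_e, which can be written without a
limit. The measure μ_u^α is affine in α and tends to δ_u. For α ≥ 1/2 a coupling of μ_u^α and μ_v^α
can be carried along, in both directions, by rescaling it and correcting the mass of the single pair
(u, v). Hence the curvature quotient is constant on [1/2, 1), and κ_e ρ_e = 2 (ρ_e - W), with W the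
transportation distance at idleness 1/2 (`curvature_mul_pathDist`).

Let S be the total weight. Since 0 ≤ ρ_e ≤ w_e and 0 ≤ W ≤ S, the field at e is at least -(2|E| + 2)
w_e and its sum over the edges is at most (2|E| + 2) S: no weight reaches 0 or blows up in finite
time.

If the weights change by factors at most r, distances change by factors at most r and the measures
share a part r⁻² of their mass (`halfTransport_sub_le`). So the field is Lipschitz on every box [m,
M]^E with m > 0. Picard–Lindelöf for the field clamped to a large box gives existence, and Lipschitz
uniqueness on boxes does the rest (`exists_isPositiveSolution_Ici`). -/

noncomputable section

namespace WeightedGraph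

/-! ### Couplings and the transportation distance -/

section Transport

variable {V : Type*} [Fintype V] {d d' : V → V → ℝ} {μ ν μ' ν' : V → ℝ}

theorem isCoupling_mul (hμ : μ ∈ stdSimplex ℝ V) (hν : ν ∈ stdSimplex ℝ V) :
    IsCoupling μ ν fun a b => μ a * ν b where
  nonneg a b := mul_nonneg (hμ.1 a) (hν.1 b)
  fst a := by rw [← Finset.mul_sum, hν.2, mul_one]
  snd b := by rw [← Finset.sum_mul, hμ.2, one_mul]

theorem transportDist_le_cost (hd : ∀ a b, 0 ≤ d a b) {π : V → V → ℝ} (hπ : IsCoupling μ ν π) :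
    transportDist d μ ν ≤ ∑ a, ∑ b, π a b * d a b := by
  refine csInf_le ⟨0, ?_⟩ ⟨π, hπ, rfl⟩
  rintro c ⟨π', hπ', rfl⟩
  exact Finset.sum_nonneg fun a _ => Finset.sum_nonneg fun b _ =>
    mul_nonneg (hπ'.nonneg a b) (hd a b)

/-- Total mass 1 provides the product coupling; without any coupling the infimum would be the
default value 0. -/
theorem le_transportDist (hμ : μ ∈ stdSimplex ℝ V) (hν : ν ∈ stdSimplex ℝ V) {c : ℝ}
    (h : ∀ π, IsCoupling μ ν π → c ≤ ∑ a, ∑ b, π a b * d a b) : c ≤ transportDist d μ ν := by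
  refine le_csInf ⟨_, _, isCoupling_mul hμ hν, rfl⟩ ?_
  rintro _ ⟨π, hπ, rfl⟩
  exact h π hπ

theorem transportDist_nonneg (hd : ∀ a b, 0 ≤ d a b) (hμ : μ ∈ stdSimplex ℝ V)
    (hν : ν ∈ stdSimplex ℝ V) : 0 ≤ transportDist d μ ν :=
  le_transportDist hμ hν fun _ hπ => Finset.sum_nonneg fun a _ => Finset.sum_nonneg fun b _ =>
    mul_nonneg (hπ.nonneg a b) (hd a b)

theorem transportDist_le_of_forall_le (hd : ∀ a b, 0 ≤ d a b) (hμ : μ ∈ stdSimplex ℝ V)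
    (hν : ν ∈ stdSimplex ℝ V) {D : ℝ} (hD : ∀ a b, d a b ≤ D) : transportDist d μ ν ≤ D := by
  refine (transportDist_le_cost hd (isCoupling_mul hμ hν)).trans ?_
  calc ∑ a, ∑ b, μ a * ν b * d a b ≤ ∑ a, ∑ b, μ a * ν b * D := by
        gcongr with a _ b _
        · exact mul_nonneg (hμ.1 a) (hν.1 b)
        · exact hD a b
    _ = D := by
        simp_rw [← Finset.sum_mul, ← Finset.mul_sum, hν.2, mul_one, hμ.2, one_mul]

/-- If `μ ≥ θ μ'` and `ν ≥ θ ν'`, a coupling of `μ'` and `ν'` scaled by `θ` and completed by an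
arbitrary transport of the remaining mass `1 - θ` is a coupling of `μ` and `ν`. -/
theorem IsCoupling.smul_add {π : V → V → ℝ} (hπ : IsCoupling μ' ν' π)
    (hμ : μ ∈ stdSimplex ℝ V) (hν : ν ∈ stdSimplex ℝ V) (hμ' : μ' ∈ stdSimplex ℝ V)
    (hν' : ν' ∈ stdSimplex ℝ V) {θ : ℝ} (h0 : 0 ≤ θ) (h1 : θ < 1)
    (hμθ : ∀ a, θ * μ' a ≤ μ a) (hνθ : ∀ a, θ * ν' a ≤ ν a) :
    IsCoupling μ ν fun a b => θ * π a b + (μ a - θ * μ' a) * (ν b - θ * ν' b) / (1 - θ) where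
  nonneg a b := add_nonneg (mul_nonneg h0 (hπ.nonneg a b)) (div_nonneg
    (mul_nonneg (sub_nonneg.2 (hμθ a)) (sub_nonneg.2 (hνθ b))) (sub_nonneg.2 h1.le))
  fst a := by
    have : 1 - θ ≠ 0 := (sub_pos.2 h1).ne'
    rw [Finset.sum_add_distrib, ← Finset.mul_sum, hπ.fst, ← Finset.sum_div, ← Finset.mul_sum,
      Finset.sum_sub_distrib, ← Finset.mul_sum, hν.2, hν'.2]
    field_simp
    ring
  snd b := by
    have : 1 - θ ≠ 0 := (sub_pos.2 h1).ne'
    rw [Finset.sum_add_distrib, ← Finset.mul_sum, hπ.snd, ← Finset.sum_div, ← Finset.sum_mul,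
      Finset.sum_sub_distrib, ← Finset.mul_sum, hμ.2, hμ'.2]
    field_simp
    ring

/-- A share θ of the mass follows a plan for μ', ν' at cost ratio r; the rest travels at most D.
This compares transportation distances when the measures and the cost vary together. -/
theorem transportDist_le_mul_add (hd : ∀ a b, 0 ≤ d a b) (hμ : μ ∈ stdSimplex ℝ V)
    (hν : ν ∈ stdSimplex ℝ V) (hμ' : μ' ∈ stdSimplex ℝ V) (hν' : ν' ∈ stdSimplex ℝ V)
    {θ r D : ℝ} (h0 : 0 < θ) (h1 : θ < 1) (hμθ : ∀ a, θ * μ' a ≤ μ a)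
    (hνθ : ∀ a, θ * ν' a ≤ ν a) (hr : 0 < r) (hdd : ∀ a b, d a b ≤ r * d' a b)
    (hD : ∀ a b, d a b ≤ D) :
    transportDist d μ ν ≤ θ * r * transportDist d' μ' ν' + (1 - θ) * D := by
  have h1' : 0 < 1 - θ := sub_pos.2 h1
  -- Solved for the distance on the right, the claim is a lower bound of an infimum, so no optimal
  -- plan is needed.
  suffices h : (transportDist d μ ν - (1 - θ) * D) / (θ * r) ≤ transportDist d' μ' ν' by
    rw [div_le_iff₀ (mul_pos h0 hr)] at h
    linarith
  refine le_transportDist hμ' hν' fun π hπ => ?_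
  rw [div_le_iff₀ (mul_pos h0 hr), sub_le_iff_le_add]
  refine (transportDist_le_cost hd
    (hπ.smul_add hμ hν hμ' hν' h0.le h1 hμθ hνθ)).trans ?_
  calc _ ≤ ∑ a, ∑ b, (θ * π a b * (r * d' a b) +
        (μ a - θ * μ' a) * (ν b - θ * ν' b) / (1 - θ) * D) := by
        gcongr with a _ b _
        rw [add_mul]
        have h2 := hπ.nonneg a b
        have h3 := sub_nonneg.2 (hμθ a)
        have h4 := sub_nonneg.2 (hνθ b)
        gcongr
        · exact hdd a b
        · exact hD a b
    _ = _ := by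
        simp_rw [Finset.sum_add_distrib, ← Finset.sum_mul, ← Finset.sum_div, ← Finset.mul_sum,
          ← Finset.sum_mul, Finset.sum_sub_distrib, ← Finset.mul_sum, hμ.2, hν.2, hμ'.2, hν'.2]
        congr 1
        · rw [Finset.sum_mul]
          refine Finset.sum_congr rfl fun a _ => ?_
          rw [Finset.sum_mul]
          refine Finset.sum_congr rfl fun b _ => ?_
          ring
        · field_simp

/-- Moving all the mass towards `u` and `v` at the same rate turns couplings into couplings, as
long as the pair `(u, v)` keeps a nonnegative mass. -/
theorem transportDist_le_of_dirac_mix [DecidableEq V] (hd : ∀ a b, 0 ≤ d a b)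
    (hμ : μ ∈ stdSimplex ℝ V) (hν : ν ∈ stdSimplex ℝ V) {u v : V} {t : ℝ} (ht : 0 < t)
    (hμ' : ∀ a, μ' a = t * μ a + (1 - t) * if a = u then 1 else 0)
    (hν' : ∀ a, ν' a = t * ν a + (1 - t) * if a = v then 1 else 0)
    (huv : 0 ≤ t * (μ u + ν v - 1) + (1 - t)) :
    transportDist d μ' ν' ≤ t * transportDist d μ ν + (1 - t) * d u v := by
  suffices h : (transportDist d μ' ν' - (1 - t) * d u v) / t ≤ transportDist d μ ν by
    rw [div_le_iff₀ ht] at h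
    linarith
  refine le_transportDist hμ hν fun π hπ => ?_
  rw [div_le_iff₀ ht, sub_le_iff_le_add]
  -- In row u the entries outside column v sum to at most 1 - ν v. For t > 1 the new plan removes
  -- mass at (u, v) only, and this bound keeps that entry nonnegative.
  have hmass : μ u + ν v - 1 ≤ π u v := by
    have e1 : π u v + ∑ b ∈ Finset.univ.erase v, π u b = μ u := by
      rw [Finset.add_sum_erase _ _ (Finset.mem_univ v), hπ.fst]
    have e2 : ν v + ∑ b ∈ Finset.univ.erase v, ν b = 1 := by
      rw [Finset.add_sum_erase _ _ (Finset.mem_univ v), hν.2]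
    have e3 : ∑ b ∈ Finset.univ.erase v, π u b ≤ ∑ b ∈ Finset.univ.erase v, ν b :=
      Finset.sum_le_sum fun b _ => by
        rw [← hπ.snd b]
        exact Finset.single_le_sum (f := fun a => π a b) (fun a _ => hπ.nonneg a b)
          (Finset.mem_univ u)
    linarith
  have hc : IsCoupling μ' ν' fun a b =>
      t * π a b + (1 - t) * ((if a = u then 1 else 0) * if b = v then 1 else 0) := by
    refine ⟨fun a b => ?_, fun a => ?_, fun b => ?_⟩
    · by_cases h : a = u ∧ b = v
      · obtain ⟨rfl, rfl⟩ := h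
        simp only [if_true, mul_one]
        nlinarith
      · have h0 : ((if a = u then (1 : ℝ) else 0) * if b = v then 1 else 0) = 0 := by
          grind
        rw [h0, mul_zero, add_zero]
        exact mul_nonneg ht.le (hπ.nonneg a b)
    · rw [Finset.sum_add_distrib, ← Finset.mul_sum, hπ.fst, ← Finset.mul_sum, ← Finset.mul_sum,
        hμ']
      simp
    · rw [Finset.sum_add_distrib, ← Finset.mul_sum, hπ.snd, ← Finset.mul_sum, ← Finset.sum_mul,
        hν']
      simp
  refine (transportDist_le_cost hd hc).trans (le_of_eq ?_)
  simp_rw [add_mul, Finset.sum_add_distrib]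
  congr 1
  · simp_rw [mul_assoc, ← Finset.mul_sum]
    ring
  · simp

end Transport

end WeightedGraph

end

noncomputable section

namespace WeightedGraph

/-! ### Dependence of the distance on the weights -/

section Distance

variable {V : Type*} {G : SimpleGraph V} {w w' : G.edgeSet → ℝ}

theorem walkLength_nonneg (hw : ∀ e, 0 < w e) {u v : V} (p : G.Walk u v) : 0 ≤ walkLength w p := by
  refine List.sum_nonneg fun x hx => ?_
  obtain ⟨a, _, rfl⟩ := List.mem_map.1 hx
  exact (hw _).le

theorem walkLength_pos (hw : ∀ e, 0 < w e) {u v : V} (huv : u ≠ v) (p : G.Walk u v) :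
    0 < walkLength w p := by
  cases p with
  | nil => exact absurd rfl huv
  | cons h q =>
    have : walkLength w (SimpleGraph.Walk.cons h q) = w ⟨s(u, _), h⟩ + walkLength w q := by
      simp [walkLength]
    rw [this]
    exact add_pos_of_pos_of_nonneg (hw _) (walkLength_nonneg hw q)

theorem walkLength_le_mul {r : ℝ} (h : ∀ e, w e ≤ r * w' e) {u v : V} (p : G.Walk u v) :
    walkLength w p ≤ r * walkLength w' p := by
  unfold walkLength
  rw [← List.sum_map_mul_left]
  exact List.sum_le_sum fun a _ => h _

/-- A path repeats no edge. -/
theorem walkLength_le_sum [Fintype G.edgeSet] (hw : ∀ e, 0 < w e) {u v : V} (p : G.Path u v) :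
    walkLength w (p : G.Walk u v) ≤ ∑ e, w e := by
  classical
  have hnd : ((p : G.Walk u v).darts.map
      fun a => (⟨a.edge, a.edge_mem⟩ : G.edgeSet)).Nodup := by
    refine List.Nodup.of_map (fun e : G.edgeSet => (e : Sym2 V)) ?_
    rw [List.map_map]
    exact p.2.isTrail.edges_nodup
  have : walkLength w (p : G.Walk u v) = ((p : G.Walk u v).darts.map
      fun a => (⟨a.edge, a.edge_mem⟩ : G.edgeSet)).toFinset.sum w := by
    rw [List.sum_toFinset _ hnd, List.map_map]
    rfl
  rw [this]
  exact Finset.sum_le_univ_sum_of_nonneg fun e => (hw e).le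

theorem pathDist_nonneg (hw : ∀ e, 0 < w e) (u v : V) : 0 ≤ pathDist w u v :=
  Real.iInf_nonneg fun p => walkLength_nonneg hw (p : G.Walk u v)

variable [Fintype V] [DecidableEq V] [DecidableRel G.Adj]

theorem pathDist_le_walkLength (w : G.edgeSet → ℝ) {u v : V} (p : G.Path u v) :
    pathDist w u v ≤ walkLength w (p : G.Walk u v) :=
  ciInf_le (Set.finite_range _).bddBelow p

/-- Paths, unlike walks, are finitely many, so the infimum is attained. -/
theorem exists_pathDist_eq (hG : G.Connected) (w : G.edgeSet → ℝ) (u v : V) :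
    ∃ p : G.Path u v, walkLength w (p : G.Walk u v) = pathDist w u v := by
  obtain ⟨p⟩ := hG.preconnected u v
  have : Nonempty (G.Path u v) := ⟨p.toPath⟩
  exact exists_eq_ciInf_of_finite

theorem pathDist_pos (hG : G.Connected) (hw : ∀ e, 0 < w e) {u v : V} (huv : u ≠ v) :
    0 < pathDist w u v := by
  obtain ⟨p, hp⟩ := exists_pathDist_eq hG w u v
  exact hp ▸ walkLength_pos hw huv _

theorem pathDist_le_sum (hG : G.Connected) (hw : ∀ e, 0 < w e) (u v : V) :
    pathDist w u v ≤ ∑ e, w e := by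
  obtain ⟨p, hp⟩ := exists_pathDist_eq hG w u v
  exact hp ▸ walkLength_le_sum hw p

theorem pathDist_le_of_adj (w : G.edgeSet → ℝ) {u v : V} (h : G.Adj u v) :
    pathDist w u v ≤ w ⟨s(u, v), h⟩ := by
  refine (pathDist_le_walkLength w (SimpleGraph.Path.singleton h)).trans (le_of_eq ?_)
  simp [walkLength, SimpleGraph.Path.singleton]

theorem pathDist_le_mul (hG : G.Connected) {r : ℝ} (h : ∀ e, w e ≤ r * w' e) (u v : V) :
    pathDist w u v ≤ r * pathDist w' u v := by
  obtain ⟨p, hp⟩ := exists_pathDist_eq hG w' u v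
  exact hp ▸ (pathDist_le_walkLength w p).trans (walkLength_le_mul h _)

end Distance

/-! ### The lazy random walk measures -/

section LazyMeasure

variable {V : Type*} {G : SimpleGraph V} [DecidableRel G.Adj] {w w' : G.edgeSet → ℝ}

theorem weight_of_adj (w : G.edgeSet → ℝ) {u v : V} (h : G.Adj u v) :
    weight w u v = w ⟨s(u, v), h⟩ := dif_pos h

theorem weight_of_not_adj (w : G.edgeSet → ℝ) {u v : V} (h : ¬G.Adj u v) :
    weight w u v = 0 := dif_neg h

theorem weight_nonneg (hw : ∀ e, 0 < w e) (u v : V) : 0 ≤ weight w u v := by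
  by_cases h : G.Adj u v
  · exact weight_of_adj w h ▸ (hw _).le
  · exact (weight_of_not_adj w h).ge

theorem weight_le_mul {r : ℝ} (h : ∀ e, w e ≤ r * w' e) (u v : V) :
    weight w u v ≤ r * weight w' u v := by
  by_cases huv : G.Adj u v
  · simpa only [weight_of_adj _ huv] using h _
  · simp [weight_of_not_adj _ huv]

variable [Fintype V]

theorem sum_weight_pos (hw : ∀ e, 0 < w e) {u v : V} (h : G.Adj u v) : 0 < ∑ y, weight w u y :=
  Finset.sum_pos' (fun y _ => weight_nonneg hw u y)
    ⟨v, Finset.mem_univ v, weight_of_adj w h ▸ hw _⟩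

variable [DecidableEq V]

theorem lazyMeasure_self (w : G.edgeSet → ℝ) (α : ℝ) (u : V) : lazyMeasure w α u u = α :=
  if_pos rfl

/-- The case distinction dissolves because `weight` vanishes off the edges, in particular at u
itself. The formula is affine in α. -/
theorem lazyMeasure_eq (w : G.edgeSet → ℝ) (α : ℝ) (u z : V) :
    lazyMeasure w α u z =
      (if z = u then α else 0) + (1 - α) * (weight w u z / ∑ y, weight w u y) := by
  unfold lazyMeasure
  by_cases hz : z = u
  · subst hz
    simp [weight_of_not_adj w (G.loopless.irrefl z)]
  · by_cases ha : G.Adj u z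
    · simp [hz, ha]
    · simp [hz, ha, weight_of_not_adj w ha]

theorem lazyMeasure_mem_stdSimplex (hw : ∀ e, 0 < w e) {α : ℝ} (h0 : 0 ≤ α) (h1 : α ≤ 1)
    {u v : V} (h : G.Adj u v) : lazyMeasure w α u ∈ stdSimplex ℝ V := by
  refine ⟨fun z => ?_, ?_⟩
  · rw [lazyMeasure_eq]
    have := weight_nonneg hw u z
    have := sum_weight_pos hw h
    have := sub_nonneg.2 h1
    split_ifs <;> positivity
  · simp_rw [lazyMeasure_eq, Finset.sum_add_distrib, ← Finset.mul_sum, ← Finset.sum_div]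
    rw [div_self (sum_weight_pos hw h).ne']
    simp

theorem lazyMeasure_eq_mix (w : G.edgeSet → ℝ) {α β t : ℝ} (h : 1 - α = t * (1 - β)) (u z : V) :
    lazyMeasure w α u z =
      t * lazyMeasure w β u z + (1 - t) * if z = u then 1 else 0 := by
  rw [lazyMeasure_eq, lazyMeasure_eq, h]
  split_ifs
  · linear_combination -h
  · ring

/-- One factor r comes from the weight in the numerator, the other from the normalizing sum. -/
theorem mul_lazyMeasure_le (hw : ∀ e, 0 < w e) (hw' : ∀ e, 0 < w' e) {r : ℝ} (hr : 1 ≤ r)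
    (h : ∀ e, w e ≤ r * w' e) (h' : ∀ e, w' e ≤ r * w e) {α : ℝ} (h0 : 0 ≤ α) (h1 : α ≤ 1)
    {u v : V} (huv : G.Adj u v) (z : V) :
    (r ^ 2)⁻¹ * lazyMeasure w' α u z ≤ lazyMeasure w α u z := by
  have hr0 : 0 < r := one_pos.trans_le hr
  have hs := sum_weight_pos hw huv
  have hs' := sum_weight_pos hw' huv
  have hss : ∑ y, weight w u y ≤ r * ∑ y, weight w' u y := by
    rw [Finset.mul_sum]
    exact Finset.sum_le_sum fun y _ => weight_le_mul h u y
  rw [lazyMeasure_eq, lazyMeasure_eq, mul_add, mul_left_comm]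
  have hdiv : (r ^ 2)⁻¹ * (weight w' u z / ∑ y, weight w' u y) ≤
      weight w u z / ∑ y, weight w u y := by
    rw [inv_mul_le_iff₀ (by positivity), mul_div_assoc', div_le_div_iff₀ hs' hs]
    calc weight w' u z * ∑ y, weight w u y
        ≤ (r * weight w u z) * (r * ∑ y, weight w' u y) := by
          gcongr
          · exact mul_nonneg hr0.le (weight_nonneg hw u z)
          · exact weight_le_mul h' u z
      _ = _ := by ring
  gcongr
  · have : (r ^ 2)⁻¹ ≤ 1 := inv_le_one_of_one_le₀ (one_le_pow₀ hr)
    split_ifs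
    · nlinarith
    · simp

end LazyMeasure

/-! ### The curvature as a transportation distance at idleness 1/2 -/

section Curvature

variable {V : Type*} [Fintype V] [DecidableEq V] {G : SimpleGraph V} [DecidableRel G.Adj]
  {w w' : G.edgeSet → ℝ}

/-- The transportation distance of the measures of idleness `1/2`. -/
def halfTransport (w : G.edgeSet → ℝ) (u v : V) : ℝ :=
  transportDist (pathDist w) (lazyMeasure w (1 / 2) u) (lazyMeasure w (1 / 2) v)

/-- The hypotheses are symmetric in α and β, so applying this twice gives equality. -/
theorem transportDist_lazyMeasure_le (hw : ∀ e, 0 < w e) {u v : V} (h : G.Adj u v) {α β : ℝ}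
    (hα : 1 / 2 ≤ α) (hα1 : α < 1) (hβ : 1 / 2 ≤ β) (hβ1 : β < 1) :
    (transportDist (pathDist w) (lazyMeasure w α u) (lazyMeasure w α v) - pathDist w u v)
        / (1 - α) ≤
      (transportDist (pathDist w) (lazyMeasure w β u) (lazyMeasure w β v) - pathDist w u v)
        / (1 - β) := by
  have hα' : 0 < 1 - α := sub_pos.2 hα1
  have hβ' : 0 < 1 - β := sub_pos.2 hβ1
  have ht : 1 - α = (1 - α) / (1 - β) * (1 - β) := by field_simp
  have key := transportDist_le_of_dirac_mix (pathDist_nonneg hw)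
    (lazyMeasure_mem_stdSimplex hw (by linarith) hβ1.le h)
    (lazyMeasure_mem_stdSimplex hw (by linarith) hβ1.le h.symm)
    (t := (1 - α) / (1 - β)) (by positivity)
    (lazyMeasure_eq_mix w ht u) (lazyMeasure_eq_mix w ht v)
    -- With t = (1 - α) / (1 - β) the condition reads 2α - 1 ≥ 0; this is where idleness 1/2 comes
    -- from.
    (by rw [lazyMeasure_self, lazyMeasure_self]; nlinarith)
  rw [div_le_iff₀ hα']
  refine (sub_le_sub_right key _).trans (le_of_eq ?_)
  field_simp
  ring

/-- The quotient that defines the curvature is constant on `[1/2, 1)`. -/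
theorem curvatureQuotient_eq (hG : G.Connected) (hw : ∀ e, 0 < w e) {u v : V} (h : G.Adj u v)
    {α : ℝ} (hα : 1 / 2 ≤ α) (hα1 : α < 1) :
    curvatureQuotient w u v α = 2 * (pathDist w u v - halfTransport w u v) / pathDist w u v := by
  have hd := (pathDist_pos hG hw h.ne).ne'
  have h1 := transportDist_lazyMeasure_le hw h hα hα1 le_rfl (by norm_num)
  have h2 := transportDist_lazyMeasure_le hw h le_rfl (by norm_num) hα hα1
  have h3 := le_antisymm h1 h2
  have hα' : 1 - α ≠ 0 := (sub_pos.2 hα1).ne'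
  unfold curvatureQuotient halfTransport
  rw [div_eq_iff hα'] at h3
  rw [eq_add_of_sub_eq h3]
  field_simp
  ring

theorem tendsto_curvatureQuotient (hG : G.Connected) (hw : ∀ e, 0 < w e) {u v : V}
    (h : G.Adj u v) :
    Tendsto (curvatureQuotient w u v) (𝓝[<] 1)
      (𝓝 (2 * (pathDist w u v - halfTransport w u v) / pathDist w u v)) := by
  refine tendsto_const_nhds.congr' ?_
  filter_upwards [Ioo_mem_nhdsLT (show (1 / 2 : ℝ) < 1 by norm_num)] with α hα
  exact (curvatureQuotient_eq hG hw h hα.1.le hα.2).symm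

theorem curvature_mul_pathDist (hG : G.Connected) (hw : ∀ e, 0 < w e) {u v : V}
    (h : G.Adj u v) :
    curvature w u v * pathDist w u v = 2 * (pathDist w u v - halfTransport w u v) := by
  rw [curvature, (tendsto_curvatureQuotient hG hw h).limUnder_eq,
    div_mul_cancel₀ _ (pathDist_pos hG hw h.ne).ne']

theorem halfTransport_nonneg (hw : ∀ e, 0 < w e) {u v : V} (h : G.Adj u v) :
    0 ≤ halfTransport w u v :=
  transportDist_nonneg (pathDist_nonneg hw)
    (lazyMeasure_mem_stdSimplex hw (by norm_num) (by norm_num) h)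
    (lazyMeasure_mem_stdSimplex hw (by norm_num) (by norm_num) h.symm)

theorem halfTransport_le_sum (hG : G.Connected) (hw : ∀ e, 0 < w e) {u v : V} (h : G.Adj u v) :
    halfTransport w u v ≤ ∑ e, w e :=
  transportDist_le_of_forall_le (pathDist_nonneg hw)
    (lazyMeasure_mem_stdSimplex hw (by norm_num) (by norm_num) h)
    (lazyMeasure_mem_stdSimplex hw (by norm_num) (by norm_num) h.symm) (pathDist_le_sum hG hw)

theorem halfTransport_sub_le (hG : G.Connected) (hw : ∀ e, 0 < w e) (hw' : ∀ e, 0 < w' e) {r : ℝ}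
    (hr : 1 < r) (h : ∀ e, w e ≤ r * w' e) (h' : ∀ e, w' e ≤ r * w e) {u v : V}
    (huv : G.Adj u v) :
    halfTransport w u v - halfTransport w' u v ≤ 2 * (r - 1) * ∑ e, w e := by
  have hr0 : 0 < r := one_pos.trans hr
  have key : halfTransport w u v ≤ (r ^ 2)⁻¹ * r * halfTransport w' u v +
      (1 - (r ^ 2)⁻¹) * ∑ e, w e :=
    transportDist_le_mul_add (pathDist_nonneg hw)
      (lazyMeasure_mem_stdSimplex hw (by norm_num) (by norm_num) huv)
      (lazyMeasure_mem_stdSimplex hw (by norm_num) (by norm_num) huv.symm)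
      (lazyMeasure_mem_stdSimplex hw' (by norm_num) (by norm_num) huv)
      (lazyMeasure_mem_stdSimplex hw' (by norm_num) (by norm_num) huv.symm)
      (by positivity) (inv_lt_one_of_one_lt₀ (one_lt_pow₀ hr two_ne_zero))
      (mul_lazyMeasure_le hw hw' hr.le h h' (by norm_num) (by norm_num) huv)
      (mul_lazyMeasure_le hw hw' hr.le h h' (by norm_num) (by norm_num) huv.symm)
      hr0 (pathDist_le_mul hG h) (pathDist_le_sum hG hw)
  have h1 : (r ^ 2)⁻¹ * r ≤ 1 := by
    rw [inv_mul_le_iff₀ (by positivity)]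
    nlinarith
  have h2 : 1 - (r ^ 2)⁻¹ ≤ 2 * (r - 1) := by
    have : 1 - 2 * (r - 1) ≤ (r ^ 2)⁻¹ := by
      rw [inv_eq_one_div, le_div_iff₀ (by positivity)]
      -- The claim is 2r³ - 3r² + 1 ≥ 0, and the left side is (r - 1)² (2r + 1).
      nlinarith [mul_nonneg (sq_nonneg (r - 1)) (show 0 ≤ 2 * r + 1 by positivity)]
    linarith
  have h3 := halfTransport_nonneg hw' huv
  have h4 : 0 ≤ ∑ e, w e := Finset.sum_nonneg fun e _ => (hw e).le
  nlinarith

end Curvature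

end WeightedGraph

end

/-! ### Global flows of vector fields in the positive orthant -/

noncomputable section

theorem exists_pos_forall_le_of_finite {ι : Type*} [Finite ι] {x : ι → ℝ} (hx : ∀ i, 0 < x i) :
    ∃ m, 0 < m ∧ m ≤ 1 ∧ ∀ i, m ≤ x i := by
  cases isEmpty_or_nonempty ι
  · exact ⟨1, one_pos, le_rfl, fun i => isEmptyElim i⟩
  · obtain ⟨i, hi⟩ := Finite.exists_min x
    exact ⟨min 1 (x i), lt_min one_pos (hx i), min_le_left _ _,
      fun j => (min_le_right _ _).trans (hi j)⟩

section PositiveFlow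

variable {ι : Type*}

/-- The projection of a vector to the box `[m, M]^ι`. -/
def clampBox (m M : ℝ) (x : ι → ℝ) (i : ι) : ℝ := max m (min M (x i))

theorem clampBox_mem {m M : ℝ} (h : m ≤ M) (x : ι → ℝ) :
    clampBox m M x ∈ Set.Icc (fun _ : ι => m) (fun _ => M) :=
  ⟨fun _ => le_max_left _ _, fun _ => max_le h (min_le_left _ _)⟩

theorem clampBox_apply_of_mem {m M : ℝ} {x : ι → ℝ} {i : ι} (h : m ≤ x i) (h' : x i ≤ M) :
    clampBox m M x i = x i := by
  rw [clampBox, min_eq_right h', max_eq_right h]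

variable [Fintype ι] {X : (ι → ℝ) → ι → ℝ} {x₀ : ι → ℝ}

/-- `y` is an integral curve of `X` on `s ∋ 0` within the positive orthant, starting at `x₀`. -/
def IsPositiveSolution (X : (ι → ℝ) → ι → ℝ) (x₀ : ι → ℝ) (s : Set ℝ) (y : ℝ → ι → ℝ) : Prop :=
  y 0 = x₀ ∧ ∀ t ∈ s, (∀ i, 0 < y t i) ∧ HasDerivWithinAt y (X (y t)) s t

theorem IsPositiveSolution.mono {s s' : Set ℝ} {y : ℝ → ι → ℝ}
    (h : IsPositiveSolution X x₀ s y) (hs : s' ⊆ s) : IsPositiveSolution X x₀ s' y :=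
  ⟨h.1, fun t ht => ⟨(h.2 t (hs ht)).1, (h.2 t (hs ht)).2.mono hs⟩⟩

theorem IsPositiveSolution.continuousOn {s : Set ℝ} {y : ℝ → ι → ℝ}
    (h : IsPositiveSolution X x₀ s y) : ContinuousOn y s :=
  fun t ht => (h.2 t ht).2.continuousWithinAt

theorem IsPositiveSolution.exists_mem_Icc {T : ℝ} {y : ℝ → ι → ℝ}
    (h : IsPositiveSolution X x₀ (Set.Icc 0 T) y) :
    ∃ m M : ℝ, 0 < m ∧ ∀ t ∈ Set.Icc 0 T, y t ∈ Set.Icc (fun _ => m) (fun _ => M) := by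
  rcases lt_or_ge T 0 with hT | hT
  · exact ⟨1, 1, one_pos, fun t ht => absurd (ht.1.trans ht.2) hT.not_ge⟩
  have hc : ∀ i, ∃ c, 0 < c ∧ ∀ t ∈ Set.Icc 0 T, c ≤ y t i := fun i => by
    obtain ⟨t, ht, hmin⟩ := isCompact_Icc.exists_isMinOn (Set.nonempty_Icc.2 hT)
      ((continuous_apply i).comp_continuousOn h.continuousOn)
    exact ⟨y t i, (h.2 t ht).1 i, fun s hs => hmin hs⟩
  choose c hc0 hc using hc
  obtain ⟨m, hm, -, hmc⟩ := exists_pos_forall_le_of_finite hc0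
  obtain ⟨M, hM⟩ := isCompact_Icc.exists_bound_of_continuousOn h.continuousOn
  exact ⟨m, M, hm, fun t ht => ⟨fun i => (hmc i).trans (hc i t ht), fun i =>
    (le_abs_self _).trans ((norm_le_pi_norm (y t) i).trans (hM t ht))⟩⟩

/-- By compactness of [0, T] both curves stay in one box of the open orthant, where the field is
Lipschitz. -/
theorem IsPositiveSolution.eqOn
    (hlip : ∀ m M : ℝ, 0 < m → ∃ K, LipschitzOnWith K X (Set.Icc (fun _ => m) (fun _ => M)))
    {T : ℝ} {y z : ℝ → ι → ℝ} (hy : IsPositiveSolution X x₀ (Set.Icc 0 T) y)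
    (hz : IsPositiveSolution X x₀ (Set.Icc 0 T) z) : Set.EqOn y z (Set.Icc 0 T) := by
  obtain ⟨m₁, M₁, hm₁, h₁⟩ := hy.exists_mem_Icc
  obtain ⟨m₂, M₂, hm₂, h₂⟩ := hz.exists_mem_Icc
  obtain ⟨K, hK⟩ := hlip (min m₁ m₂) (max M₁ M₂) (lt_min hm₁ hm₂)
  have hsub₁ : Set.Icc (fun _ : ι => m₁) (fun _ => M₁) ⊆
      Set.Icc (fun _ => min m₁ m₂) (fun _ => max M₁ M₂) :=
    Set.Icc_subset_Icc (fun _ => min_le_left _ _) (fun _ => le_max_left _ _)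
  have hsub₂ : Set.Icc (fun _ : ι => m₂) (fun _ => M₂) ⊆
      Set.Icc (fun _ => min m₁ m₂) (fun _ => max M₁ M₂) :=
    Set.Icc_subset_Icc (fun _ => min_le_right _ _) (fun _ => le_max_right _ _)
  refine ODE_solution_unique_of_mem_Icc_right (v := fun _ => X) (fun _ _ => hK)
    hy.continuousOn (fun t ht => ?_) (fun t ht => hsub₁ (h₁ t (Set.Ico_subset_Icc_self ht)))
    hz.continuousOn (fun t ht => ?_) (fun t ht => hsub₂ (h₂ t (Set.Ico_subset_Icc_self ht)))
    (hy.1.trans hz.1.symm)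
  · exact (hy.2 t (Set.Ico_subset_Icc_self ht)).2.mono_of_mem_nhdsWithin
      (Icc_mem_nhdsGE_of_mem ht)
  · exact (hz.2 t (Set.Ico_subset_Icc_self ht)).2.mono_of_mem_nhdsWithin
      (Icc_mem_nhdsGE_of_mem ht)

theorem lipschitzWith_clampBox (m M : ℝ) : LipschitzWith 1 (clampBox m M : (ι → ℝ) → ι → ℝ) := by
  refine LipschitzWith.of_dist_le_mul fun x y => ?_
  rw [NNReal.coe_one, one_mul, dist_pi_le_iff dist_nonneg]
  intro i
  refine le_trans ?_ (dist_le_pi_dist x y i)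
  simp only [clampBox, Real.dist_eq, max_comm m, min_comm M]
  exact (abs_max_sub_max_le_abs _ _ _).trans (abs_inf_sub_inf_le_abs _ _ _)

/-- A bounded Lipschitz vector field has integral curves on every interval `[0, T]`. -/
theorem exists_forall_hasDerivWithinAt_of_bounded {Z : (ι → ℝ) → ι → ℝ} {K : NNReal}
    (hZ : LipschitzWith K Z) {L : ℝ} (hL : ∀ x, ‖Z x‖ ≤ L) (x₀ : ι → ℝ) {T : ℝ} (hT : 0 ≤ T) :
    ∃ y : ℝ → ι → ℝ, y 0 = x₀ ∧
      ∀ t ∈ Set.Icc 0 T, HasDerivWithinAt y (Z (y t)) (Set.Icc 0 T) t := by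
  have hL0 : 0 ≤ L := (norm_nonneg _).trans (hL 0)
  lift L to NNReal using hL0
  lift T to NNReal using hT
  -- At speed at most L a curve stays within distance L T of its start up to time T.
  have hP : IsPicardLindelof (fun _ => Z) (⟨0, le_rfl, T.2⟩ : Set.Icc (0 : ℝ) T) x₀
      (L * T) 0 L K :=
    .of_time_independent (fun x _ => hL x) hZ.lipschitzOnWith (by simp)
  exact hP.exists_eq_forall_mem_Icc_hasDerivWithinAt₀

/-- The clamped field is bounded and Lipschitz, so it has a curve on [0, T]. Exponential barriers
keep this curve in the box, where clamping changes nothing. -/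
theorem exists_isPositiveSolution_Icc {C : ℝ} (hC : 0 ≤ C)
    (hlow : ∀ x : ι → ℝ, (∀ i, 0 < x i) → ∀ i, -(C * x i) ≤ X x i)
    (hup : ∀ x : ι → ℝ, (∀ i, 0 < x i) → ∑ i, X x i ≤ C * ∑ i, x i)
    (hlip : ∀ m M : ℝ, 0 < m → ∃ K, LipschitzOnWith K X (Set.Icc (fun _ => m) (fun _ => M)))
    (hx₀ : ∀ i, 0 < x₀ i) {T : ℝ} (hT : 0 ≤ T) :
    ∃ y, IsPositiveSolution X x₀ (Set.Icc 0 T) y := by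
  obtain ⟨m₀, hm₀, hm₀1, hm₀x⟩ := exists_pos_forall_le_of_finite hx₀
  -- The extra 1 makes the barrier inequalities strict at contact.
  set C' := C + 1 with hC'
  have hC'0 : 0 < C' := by positivity
  -- The extra 1 keeps the upper barrier positive even without coordinates, and gives m ≤ m₀ ≤ 1 ≤
  -- S₀ ≤ M.
  set S₀ := ∑ i, x₀ i + 1 with hS₀
  have hS₀1 : 1 ≤ S₀ := by
    have := Finset.sum_nonneg fun i (_ : i ∈ Finset.univ) => (hx₀ i).le
    linarith
  set m := m₀ * Real.exp (-C' * T) with hm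
  set M := S₀ * Real.exp (C' * T) with hM
  have hm0 : 0 < m := by positivity
  have hmm₀ : m ≤ m₀ := mul_le_of_le_one_right hm₀.le (Real.exp_le_one_iff.2 (by nlinarith))
  have hS₀M : S₀ ≤ M := le_mul_of_one_le_right (by linarith) (Real.one_le_exp (by positivity))
  have hmM : m ≤ M := by linarith
  obtain ⟨K, hK⟩ := hlip m M hm0
  obtain ⟨L, hL⟩ := isCompact_Icc.exists_bound_of_continuousOn hK.continuousOn
  have hZ : LipschitzWith (K * 1) (X ∘ clampBox m M) := by
    rw [← lipschitzOnWith_univ]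
    exact hK.comp (lipschitzWith_clampBox m M).lipschitzOnWith fun x _ => clampBox_mem hmM x
  obtain ⟨y, hy0, hy⟩ := exists_forall_hasDerivWithinAt_of_bounded hZ
    (fun x => hL _ (clampBox_mem hmM x)) x₀ hT
  have hclpos : ∀ x : ι → ℝ, ∀ i, 0 < clampBox m M x i := fun x i =>
    hm0.trans_le ((clampBox_mem hmM x).1 i)
  have hcont : ContinuousOn y (Set.Icc 0 T) := fun t ht => (hy t ht).continuousWithinAt
  have hderiv : ∀ i, ∀ t ∈ Set.Ico 0 T,
      HasDerivWithinAt (fun s => y s i) (X (clampBox m M (y t)) i) (Set.Ici t) t := fun i t ht =>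
    hasDerivWithinAt_pi.1 ((hy t (Set.Ico_subset_Icc_self ht)).mono_of_mem_nhdsWithin
      (Icc_mem_nhdsGE_of_mem ht)) i
  have hexp : ∀ c a t : ℝ, HasDerivAt (fun s => a * Real.exp (c * s))
      (c * (a * Real.exp (c * t))) t := fun c a t => by
    exact (((hasDerivAt_id' t).const_mul c).exp.const_mul a).congr_deriv (by ring)
  have hlower : ∀ i, ∀ t ∈ Set.Icc 0 T, m₀ * Real.exp (-C' * t) ≤ y t i := fun i t ht => by
    have := image_le_of_deriv_right_lt_deriv_boundary (f := fun s => -y s i)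
      (B := fun s => -(m₀ * Real.exp (-C' * s)))
      ((continuous_apply i).comp_continuousOn hcont).neg (fun s hs => (hderiv i s hs).neg)
      (by simpa [hy0] using hm₀x i) (fun s => (hexp (-C') m₀ s).neg) (fun s hs hs' => ?_) ht
    · exact neg_le_neg_iff.1 this
    -- At contact, coordinate i lies in [m, M] and is not clamped. Other coordinates may be, but the
    -- bound `hlow` involves only x i.
    · have he : y s i = m₀ * Real.exp (-C' * s) := neg_injective hs'
      have h1 : m ≤ y s i := by
        rw [he, hm]
        gcongr m₀ * Real.exp ?_
        nlinarith [hs.2]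
      have h2 : y s i ≤ M := by
        rw [he]
        refine (mul_le_of_le_one_right hm₀.le (Real.exp_le_one_iff.2 ?_)).trans (by linarith)
        nlinarith [hs.1]
      have h3 := hlow _ (hclpos (y s)) i
      rw [clampBox_apply_of_mem h1 h2] at h3
      rw [← he]
      nlinarith
  have hlower' : ∀ i, ∀ t ∈ Set.Icc 0 T, m ≤ y t i := fun i t ht => by
    refine le_trans ?_ (hlower i t ht)
    rw [hm]
    gcongr m₀ * Real.exp ?_
    nlinarith [ht.2]
  have hupper : ∀ t ∈ Set.Icc 0 T, ∑ i, y t i ≤ S₀ * Real.exp (C' * t) := by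
    refine image_le_of_deriv_right_lt_deriv_boundary (f := fun s => ∑ i, y s i)
      (continuousOn_finsetSum _ fun i _ => (continuous_apply i).comp_continuousOn hcont)
      (fun s hs => HasDerivWithinAt.fun_sum fun i _ => hderiv i s hs)
      (by simp [hy0, hS₀]) (hexp C' S₀) (fun s hs hs' => ?_)
    have hs2 := Set.Ico_subset_Icc_self hs
    -- Once the lower barrier holds, clamping can only decrease coordinates.
    have h1 : ∑ i, clampBox m M (y s) i ≤ ∑ i, y s i := Finset.sum_le_sum fun i _ =>
      max_le (hlower' i s hs2) (min_le_right _ _)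
    have h2 := hup _ (hclpos (y s))
    have h3 : 0 < S₀ * Real.exp (C' * s) := by positivity
    rw [← hs'] at h3 ⊢
    nlinarith
  refine ⟨y, hy0, fun t ht => ?_⟩
  have hcl : clampBox m M (y t) = y t := by
    funext i
    refine clampBox_apply_of_mem (hlower' i t ht) ?_
    calc y t i ≤ ∑ j, y t j := Finset.single_le_sum (f := y t)
          (fun j _ => hm0.le.trans (hlower' j t ht)) (Finset.mem_univ i)
      _ ≤ S₀ * Real.exp (C' * t) := hupper t ht
      _ ≤ M := by
        rw [hM]
        gcongr
        exact ht.2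
  refine ⟨fun i => hm0.trans_le (hlower' i t ht), ?_⟩
  have := hy t ht
  rwa [Function.comp_apply, hcl] at this

/-- A vector field that is Lipschitz on the boxes in the positive orthant, does not decrease
coordinates faster than exponentially, and does not increase their sum faster than
exponentially, has a unique integral curve on `[0, ∞)` from every point of the orthant. -/
theorem exists_isPositiveSolution_Ici {C : ℝ} (hC : 0 ≤ C)
    (hlow : ∀ x : ι → ℝ, (∀ i, 0 < x i) → ∀ i, -(C * x i) ≤ X x i)
    (hup : ∀ x : ι → ℝ, (∀ i, 0 < x i) → ∑ i, X x i ≤ C * ∑ i, x i)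
    (hlip : ∀ m M : ℝ, 0 < m → ∃ K, LipschitzOnWith K X (Set.Icc (fun _ => m) (fun _ => M)))
    (hx₀ : ∀ i, 0 < x₀ i) :
    ∃ y, IsPositiveSolution X x₀ (Set.Ici 0) y ∧
      ∀ z, IsPositiveSolution X x₀ (Set.Ici 0) z → Set.EqOn z y (Set.Ici 0) := by
  -- The interval [0, n + 1] contains a neighbourhood in [0, ∞) of each time with floor n, so the
  -- glued curve is differentiable at integers too.
  have hex : ∀ n : ℕ, ∃ y, IsPositiveSolution X x₀ (Set.Icc 0 ((n : ℝ) + 1)) y := fun n =>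
    exists_isPositiveSolution_Icc hC hlow hup hlip hx₀ (by positivity)
  choose Y hY using hex
  have hglue : ∀ N : ℕ, ∀ s : ℝ, 0 ≤ s → s < (N : ℝ) + 1 → Y ⌊s⌋₊ s = Y N s := by
    intro N s hs hsN
    have hle : ⌊s⌋₊ ≤ N := by
      rw [← Nat.lt_add_one_iff, Nat.floor_lt hs]
      exact_mod_cast hsN
    have hle' : (⌊s⌋₊ : ℝ) + 1 ≤ (N : ℝ) + 1 := by exact_mod_cast Nat.succ_le_succ hle
    exact (hY _).eqOn hlip ((hY N).mono (Set.Icc_subset_Icc_right hle'))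
      ⟨hs, (Nat.lt_floor_add_one s).le⟩
  have hsol : IsPositiveSolution X x₀ (Set.Ici 0) fun s => Y ⌊s⌋₊ s := by
    refine ⟨by simpa using (hY 0).1, fun t ht => ?_⟩
    have ht0 : (0 : ℝ) ≤ t := ht
    have htN := Nat.lt_floor_add_one t
    obtain ⟨hpos, hd⟩ := hY ⌊t⌋₊ |>.2 t ⟨ht0, htN.le⟩
    refine ⟨hpos, ?_⟩
    have hmem : Set.Ico 0 ((⌊t⌋₊ : ℝ) + 1) ∈ 𝓝[Set.Ici 0] t := by
      rw [← Set.Ici_inter_Iio]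
      exact inter_mem_nhdsWithin _ (Iio_mem_nhds htN)
    refine (hd.mono_of_mem_nhdsWithin
      (mem_of_superset hmem Set.Ico_subset_Icc_self)).congr_of_eventuallyEq ?_ rfl
    filter_upwards [hmem] with s hs using hglue _ s hs.1 hs.2
  refine ⟨_, hsol, fun z hz t ht => ?_⟩
  exact (hz.mono Set.Icc_subset_Ici_self).eqOn hlip (hsol.mono Set.Icc_subset_Ici_self)
    ⟨ht, le_rfl⟩

end PositiveFlow

end

noncomputable section

/-! ### Calculus of bounded Lipschitz functions -/

section BoundedLipschitz

variable {E : Type*} [PseudoMetricSpace E] {s : Set E} {f g : E → ℝ}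

/-- `f` is bounded and Lipschitz on `s`. -/
def IsBoundedLipschitzOn (f : E → ℝ) (s : Set E) : Prop :=
  (∃ B, ∀ x ∈ s, |f x| ≤ B) ∧ ∃ K, ∀ x ∈ s, ∀ y ∈ s, |f x - f y| ≤ K * dist x y

namespace IsBoundedLipschitzOn

theorem congr (hf : IsBoundedLipschitzOn f s) (h : ∀ x ∈ s, g x = f x) :
    IsBoundedLipschitzOn g s := by
  obtain ⟨⟨B, hB⟩, K, hK⟩ := hf
  exact ⟨⟨B, fun x hx => h x hx ▸ hB x hx⟩, K, fun x hx y hy => by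
    rw [h x hx, h y hy]
    exact hK x hx y hy⟩

theorem const (c : ℝ) : IsBoundedLipschitzOn (fun _ => c) s :=
  ⟨⟨|c|, fun _ _ => le_rfl⟩, 0, fun x _ y _ => by simp⟩

theorem add (hf : IsBoundedLipschitzOn f s) (hg : IsBoundedLipschitzOn g s) :
    IsBoundedLipschitzOn (fun x => f x + g x) s := by
  obtain ⟨⟨B, hB⟩, K, hK⟩ := hf
  obtain ⟨⟨B', hB'⟩, K', hK'⟩ := hg
  refine ⟨⟨B + B', fun x hx => (abs_add_le _ _).trans (add_le_add (hB x hx) (hB' x hx))⟩,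
    K + K', fun x hx y hy => ?_⟩
  rw [add_sub_add_comm, add_mul]
  exact (abs_add_le _ _).trans (add_le_add (hK x hx y hy) (hK' x hx y hy))

theorem mul (hf : IsBoundedLipschitzOn f s) (hg : IsBoundedLipschitzOn g s) :
    IsBoundedLipschitzOn (fun x => f x * g x) s := by
  obtain ⟨⟨B, hB⟩, K, hK⟩ := hf
  obtain ⟨⟨B', hB'⟩, K', hK'⟩ := hg
  refine ⟨⟨B * B', fun x hx => ?_⟩, B * K' + B' * K, fun x hx y hy => ?_⟩
  · rw [abs_mul]
    exact mul_le_mul (hB x hx) (hB' x hx) (abs_nonneg _) ((abs_nonneg _).trans (hB x hx))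
  · have e : f x * g x - f y * g y = f x * (g x - g y) + g y * (f x - f y) := by ring
    rw [e, add_mul, mul_assoc, mul_assoc]
    refine (abs_add_le _ _).trans (add_le_add ?_ ?_) <;> rw [abs_mul]
    · exact mul_le_mul (hB x hx) (hK' x hx y hy) (abs_nonneg _) ((abs_nonneg _).trans (hB x hx))
    · exact mul_le_mul (hB' y hy) (hK x hx y hy) (abs_nonneg _) ((abs_nonneg _).trans (hB' y hy))

theorem neg (hf : IsBoundedLipschitzOn f s) : IsBoundedLipschitzOn (fun x => -f x) s :=
  ((const (-1)).mul hf).congr fun x _ => by ring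

theorem sum {ι : Type*} {F : ι → E → ℝ} (t : Finset ι)
    (hF : ∀ i ∈ t, IsBoundedLipschitzOn (F i) s) :
    IsBoundedLipschitzOn (fun x => ∑ i ∈ t, F i x) s := by
  classical
  induction t using Finset.induction_on with
  | empty => simpa using const 0
  | insert i t hi ih =>
    simp only [Finset.sum_insert hi]
    exact (hF i (Finset.mem_insert_self i t)).add
      (ih fun j hj => hF j (Finset.mem_insert_of_mem hj))

theorem inv (hf : IsBoundedLipschitzOn f s) {c : ℝ} (hc : 0 < c) (h : ∀ x ∈ s, c ≤ f x) :
    IsBoundedLipschitzOn (fun x => (f x)⁻¹) s := by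
  obtain ⟨-, K, hK⟩ := hf
  refine ⟨⟨c⁻¹, fun x hx => ?_⟩, K / (c * c), fun x hx y hy => ?_⟩
  · have := hc.trans_le (h x hx)
    rw [abs_of_pos (inv_pos.2 this)]
    exact inv_anti₀ hc (h x hx)
  · have hx0 := hc.trans_le (h x hx)
    have hy0 := hc.trans_le (h y hy)
    rw [inv_sub_inv hx0.ne' hy0.ne', abs_div, abs_of_pos (mul_pos hx0 hy0), abs_sub_comm,
      div_mul_eq_mul_div]
    exact div_le_div₀ ((abs_nonneg _).trans (hK x hx y hy)) (hK x hx y hy) (mul_pos hc hc)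
      (mul_le_mul (h x hx) (h y hy) hc.le hx0.le)

end IsBoundedLipschitzOn

theorem exists_lipschitzOnWith_pi {ι : Type*} [Fintype ι] {X : E → ι → ℝ}
    (h : ∀ i, IsBoundedLipschitzOn (fun x => X x i) s) : ∃ K, LipschitzOnWith K X s := by
  choose K hK using fun i => (h i).2
  refine ⟨∑ i, (K i).toNNReal, LipschitzOnWith.of_dist_le_mul fun x hx y hy => ?_⟩
  refine (dist_pi_le_iff (by positivity)).2 fun i => ?_
  rw [Real.dist_eq]
  refine (hK i x hx y hy).trans ?_
  gcongr
  refine (Real.le_coe_toNNReal _).trans ?_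
  exact_mod_cast Finset.single_le_sum (f := fun i => (K i).toNNReal) (fun _ _ => zero_le)
    (Finset.mem_univ i)

/-- On a box in the positive orthant, a function that changes by at most `C (r - 1)` between
vectors whose coordinates have ratios at most `r` is Lipschitz. -/
theorem isBoundedLipschitzOn_of_ratio {ι : Type*} [Fintype ι] {m M B C : ℝ} (hm : 0 < m)
    {f : (ι → ℝ) → ℝ} (hB : ∀ x ∈ Set.Icc (fun _ => m) (fun _ => M), |f x| ≤ B)
    (h : ∀ x ∈ Set.Icc (fun _ => m) (fun _ => M), ∀ y ∈ Set.Icc (fun _ => m) (fun _ => M),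
      ∀ r, 1 < r → (∀ i, x i ≤ r * y i) → (∀ i, y i ≤ r * x i) → f x - f y ≤ C * (r - 1)) :
    IsBoundedLipschitzOn f (Set.Icc (fun _ => m) (fun _ => M)) := by
  refine ⟨⟨B, hB⟩, C / m, fun x hx y hy => ?_⟩
  rcases eq_or_ne x y with rfl | hxy
  · simp
  have hd : 0 < dist x y := dist_pos.2 hxy
  -- Coordinates are at least m, so an additive error `dist x y` is a relative error at most `dist x
  -- y / m`.
  have ratio : ∀ x ∈ Set.Icc (fun _ : ι => m) (fun _ => M),
      ∀ y ∈ Set.Icc (fun _ : ι => m) (fun _ => M), ∀ i, x i ≤ (1 + dist x y / m) * y i := by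
    intro x _ y hy i
    have h1 : x i - y i ≤ dist x y := (le_abs_self _).trans (dist_le_pi_dist x y i)
    have h2 : dist x y ≤ dist x y / m * y i := by
      rw [div_mul_eq_mul_div, le_div_iff₀ hm]
      exact mul_le_mul_of_nonneg_left (hy.1 i) dist_nonneg
    linarith
  have hr : 1 < 1 + dist x y / m := lt_add_of_pos_right _ (div_pos hd hm)
  have hyx := ratio y hy x hx
  rw [dist_comm y x] at hyx
  have h1 := h x hx y hy _ hr (ratio x hx y hy) hyx
  have h2 := h y hy x hx _ hr hyx (ratio x hx y hy)
  have e : C * (1 + dist x y / m - 1) = C / m * dist x y := by ring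
  rw [e] at h1 h2
  exact abs_sub_le_iff.2 ⟨h1, h2⟩

end BoundedLipschitz

namespace WeightedGraph

/-! ### Growth and Lipschitz bounds for the Ricci flow field -/

section Flow

variable {V : Type*} [Fintype V] [DecidableEq V] {G : SimpleGraph V} [DecidableRel G.Adj]
  {w : G.edgeSet → ℝ}

theorem edgeDist_mem_Icc (hw : ∀ e, 0 < w e) (e : G.edgeSet) :
    edgeDist w e ∈ Set.Icc 0 (w e) := by
  obtain ⟨⟨x, y⟩, h⟩ := e
  exact ⟨pathDist_nonneg hw x y, pathDist_le_of_adj w h⟩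

/-- From κ_e ρ_e = 2 (ρ_e - W). The upper bound involves only w_e, which is what prevents faster
than exponential decay of that weight; the lower one involves the total. -/
theorem edgeCurvature_mul_edgeDist_mem_Icc (hG : G.Connected) (hw : ∀ e, 0 < w e)
    (e : G.edgeSet) :
    edgeCurvature w e * edgeDist w e ∈ Set.Icc (-(2 * ∑ h, w h)) (2 * w e) := by
  obtain ⟨⟨x, y⟩, h⟩ := e
  have h0 : edgeCurvature w ⟨s(x, y), h⟩ * edgeDist w ⟨s(x, y), h⟩ =
    2 * (pathDist w x y - halfTransport w x y) := curvature_mul_pathDist hG hw h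
  have h1 := halfTransport_nonneg hw h
  have h2 := halfTransport_le_sum hG hw h
  have h3 := pathDist_nonneg hw x y
  have h4 := pathDist_le_of_adj w h
  change edgeCurvature w ⟨s(x, y), h⟩ * edgeDist w ⟨s(x, y), h⟩ ∈
    Set.Icc (-(2 * ∑ h, w h)) (2 * w ⟨s(x, y), h⟩)
  rw [h0]
  constructor <;> linarith

theorem sum_div_sum_mem_Icc (hG : G.Connected) (hw : ∀ e, 0 < w e) :
    (∑ τ, edgeCurvature w τ * edgeDist w τ) / (∑ h, w h) ∈
      Set.Icc (-(2 * (Fintype.card G.edgeSet : ℝ))) 2 := by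
  have hs : 0 ≤ ∑ h, w h := Finset.sum_nonneg fun e _ => (hw e).le
  constructor
  · rcases hs.eq_or_lt with h0 | h0
    -- Total weight 0 occurs only without edges; the quotient is then 0 by convention.
    · simp [← h0]
    · rw [le_div_iff₀ h0]
      have : ∑ _τ : G.edgeSet, -(2 * ∑ h, w h) ≤ ∑ τ, edgeCurvature w τ * edgeDist w τ :=
        Finset.sum_le_sum fun τ _ => (edgeCurvature_mul_edgeDist_mem_Icc hG hw τ).1
      rw [Finset.sum_const, Finset.card_univ, nsmul_eq_mul] at this
      linarith
  · refine div_le_of_le_mul₀ hs two_pos.le ?_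
    rw [Finset.mul_sum]
    exact Finset.sum_le_sum fun τ _ => (edgeCurvature_mul_edgeDist_mem_Icc hG hw τ).2

/-- The normalizing term is also local: its bounded coefficient multiplies ρ_e ≤ w_e. -/
theorem neg_mul_le_quasiNormalizedField (hG : G.Connected) (hw : ∀ e, 0 < w e) (e : G.edgeSet) :
    -((2 * (Fintype.card G.edgeSet : ℝ) + 2) * w e) ≤ quasiNormalizedField w e := by
  obtain ⟨h1, h2⟩ := edgeDist_mem_Icc hw e
  have h3 := (edgeCurvature_mul_edgeDist_mem_Icc hG hw e).2
  have h4 := mul_le_mul_of_nonneg_right (sum_div_sum_mem_Icc hG hw).1 h1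
  have h5 : (0 : ℝ) ≤ Fintype.card G.edgeSet := Nat.cast_nonneg _
  unfold quasiNormalizedField
  nlinarith

theorem sum_quasiNormalizedField_le (hG : G.Connected) (hw : ∀ e, 0 < w e) :
    ∑ e, quasiNormalizedField w e ≤ (2 * (Fintype.card G.edgeSet : ℝ) + 2) * ∑ e, w e := by
  have h : ∀ e, quasiNormalizedField w e ≤ 2 * ∑ h, w h + 2 * w e := fun e => by
    obtain ⟨h1, h2⟩ := edgeDist_mem_Icc hw e
    have h3 := (edgeCurvature_mul_edgeDist_mem_Icc hG hw e).1
    have h4 := mul_le_mul_of_nonneg_right (sum_div_sum_mem_Icc hG hw).2 h1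
    unfold quasiNormalizedField
    linarith
  refine (Finset.sum_le_sum fun e _ => h e).trans (le_of_eq ?_)
  rw [Finset.sum_add_distrib, Finset.sum_const, Finset.card_univ, nsmul_eq_mul, ← Finset.mul_sum]
  ring

theorem sum_le_card_mul_of_mem_Icc {ι : Type*} [Fintype ι] {m M : ℝ} {x : ι → ℝ}
    (hx : x ∈ Set.Icc (fun _ => m) (fun _ => M)) : ∑ i, x i ≤ Fintype.card ι * M := by
  refine (Finset.sum_le_sum fun i _ => hx.2 i).trans (le_of_eq ?_)
  rw [Finset.sum_const, Finset.card_univ, nsmul_eq_mul]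

theorem isBoundedLipschitzOn_pathDist (hG : G.Connected) {m M : ℝ} (hm : 0 < m) (u v : V) :
    IsBoundedLipschitzOn (fun w : G.edgeSet → ℝ => pathDist w u v)
      (Set.Icc (fun _ => m) (fun _ => M)) := by
  have hpos : ∀ w ∈ Set.Icc (fun _ : G.edgeSet => m) (fun _ => M), ∀ e, 0 < w e :=
    fun w hw e => hm.trans_le (hw.1 e)
  refine isBoundedLipschitzOn_of_ratio (B := Fintype.card G.edgeSet * M)
    (C := Fintype.card G.edgeSet * M) hm (fun w hw => ?_) fun w hw w' hw' r hr h _ => ?_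
  · rw [abs_of_nonneg (pathDist_nonneg (hpos w hw) u v)]
    exact (pathDist_le_sum hG (hpos w hw) u v).trans (sum_le_card_mul_of_mem_Icc hw)
  · have h1 := pathDist_le_mul hG h u v
    have h2 := (pathDist_le_sum hG (hpos w' hw') u v).trans (sum_le_card_mul_of_mem_Icc hw')
    nlinarith

theorem isBoundedLipschitzOn_halfTransport (hG : G.Connected) {m M : ℝ} (hm : 0 < m) {u v : V}
    (huv : G.Adj u v) :
    IsBoundedLipschitzOn (fun w : G.edgeSet → ℝ => halfTransport w u v)
      (Set.Icc (fun _ => m) (fun _ => M)) := by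
  have hpos : ∀ w ∈ Set.Icc (fun _ : G.edgeSet => m) (fun _ => M), ∀ e, 0 < w e :=
    fun w hw e => hm.trans_le (hw.1 e)
  refine isBoundedLipschitzOn_of_ratio (B := Fintype.card G.edgeSet * M)
    (C := 2 * (Fintype.card G.edgeSet * M)) hm (fun w hw => ?_) fun w hw w' hw' r hr h h' => ?_
  · rw [abs_of_nonneg (halfTransport_nonneg (hpos w hw) huv)]
    exact (halfTransport_le_sum hG (hpos w hw) huv).trans (sum_le_card_mul_of_mem_Icc hw)
  · have h1 := halfTransport_sub_le hG (hpos w hw) (hpos w' hw') hr h h' huv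
    have h2 := sum_le_card_mul_of_mem_Icc hw
    nlinarith

theorem isBoundedLipschitzOn_edgeDist (hG : G.Connected) {m M : ℝ} (hm : 0 < m)
    (e : G.edgeSet) :
    IsBoundedLipschitzOn (fun w : G.edgeSet → ℝ => edgeDist w e)
      (Set.Icc (fun _ => m) (fun _ => M)) := by
  obtain ⟨⟨x, y⟩, h⟩ := e
  exact isBoundedLipschitzOn_pathDist hG hm x y

theorem isBoundedLipschitzOn_edgeCurvature_mul_edgeDist (hG : G.Connected) {m M : ℝ}
    (hm : 0 < m) (e : G.edgeSet) :
    IsBoundedLipschitzOn (fun w : G.edgeSet → ℝ => edgeCurvature w e * edgeDist w e)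
      (Set.Icc (fun _ => m) (fun _ => M)) := by
  obtain ⟨⟨x, y⟩, h⟩ := e
  refine ((IsBoundedLipschitzOn.const 2).mul ((isBoundedLipschitzOn_pathDist hG hm x y).add
    (isBoundedLipschitzOn_halfTransport hG hm h).neg)).congr fun w hw => ?_
  rw [← sub_eq_add_neg]
  exact curvature_mul_pathDist hG (fun e => hm.trans_le (hw.1 e)) h

theorem isBoundedLipschitzOn_apply {ι : Type*} [Fintype ι] {m M : ℝ} (hm : 0 < m) (i : ι) :
    IsBoundedLipschitzOn (fun x : ι → ℝ => x i) (Set.Icc (fun _ => m) (fun _ => M)) :=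
  ⟨⟨M, fun x hx => (abs_of_pos (hm.trans_le (hx.1 i))).trans_le (hx.2 i)⟩, 1, fun x _ y _ => by
    rw [one_mul, ← Real.dist_eq]
    exact dist_le_pi_dist x y i⟩

theorem exists_lipschitzOnWith_quasiNormalizedField (hG : G.Connected) (m M : ℝ) (hm : 0 < m) :
    ∃ K, LipschitzOnWith K (quasiNormalizedField (G := G))
      (Set.Icc (fun _ => m) (fun _ => M)) := by
  refine exists_lipschitzOnWith_pi fun e => ?_
  have hF := isBoundedLipschitzOn_edgeCurvature_mul_edgeDist (M := M) hG hm
  -- The fixed edge e alone bounds the total weight below by m.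
  have hsum : IsBoundedLipschitzOn (fun w : G.edgeSet → ℝ => (∑ h, w h)⁻¹)
      (Set.Icc (fun _ => m) (fun _ => M)) :=
    (IsBoundedLipschitzOn.sum Finset.univ fun e _ => isBoundedLipschitzOn_apply hm e).inv hm
      fun w hw => (hw.1 e).trans (Finset.single_le_sum (f := w)
        (fun e _ => hm.le.trans (hw.1 e)) (Finset.mem_univ e))
  refine ((hF e).neg.add (((IsBoundedLipschitzOn.sum Finset.univ fun e _ => hF e).mul
    hsum).mul (isBoundedLipschitzOn_edgeDist hG hm e))).congr fun w _ => ?_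
  rw [quasiNormalizedField, neg_mul, div_eq_mul_inv]

theorem isQuasiNormalizedFlow_iff (w₀ : G.edgeSet → ℝ) (w : ℝ → G.edgeSet → ℝ) :
    IsQuasiNormalizedFlow w₀ w ↔ IsPositiveSolution quasiNormalizedField w₀ (Set.Ici 0) w :=
  ⟨fun h => ⟨h.initial, fun t ht => ⟨h.pos t ht, hasDerivWithinAt_pi.2 (h.deriv t ht)⟩⟩,
    fun h => ⟨h.1, fun t ht => (h.2 t ht).1, fun t ht => hasDerivWithinAt_pi.1 (h.2 t ht).2⟩⟩

end Flow

end WeightedGraph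

end

theorem theorem2 {V : Type*} [Fintype V] [DecidableEq V] (G : SimpleGraph V)
    [DecidableRel G.Adj] (hG : G.Connected) :
    -- the limit that defines the curvature of an edge exists for every positive weight
    (∀ w : G.edgeSet → ℝ, (∀ e, 0 < w e) → ∀ x y : V, G.Adj x y →
      Filter.Tendsto (WeightedGraph.curvatureQuotient w x y) (nhdsWithin 1 (Set.Iio 1))
        (nhds (WeightedGraph.curvature w x y))) ∧
    -- global existence and uniqueness of the flow
    ∀ w₀ : G.edgeSet → ℝ, (∀ e, 0 < w₀ e) →
      ∃ w : ℝ → G.edgeSet → ℝ, WeightedGraph.IsQuasiNormalizedFlow w₀ w ∧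
        ∀ w' : ℝ → G.edgeSet → ℝ, WeightedGraph.IsQuasiNormalizedFlow w₀ w' →
          Set.EqOn w' w (Set.Ici 0) := by
  refine ⟨fun w hw x y h => ?_, fun w₀ hw₀ => ?_⟩
  · exact tendsto_nhds_limUnder ⟨_, WeightedGraph.tendsto_curvatureQuotient hG hw h⟩
  · simp only [WeightedGraph.isQuasiNormalizedFlow_iff]
    exact exists_isPositiveSolution_Ici (by positivity)
      (fun w hw => WeightedGraph.neg_mul_le_quasiNormalizedField hG hw)
      (fun w hw => WeightedGraph.sum_quasiNormalizedField_le hG hw)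
      (WeightedGraph.exists_lipschitzOnWith_quasiNormalizedField hG) hw₀
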